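/- A group $G$ is centreless if its centre is trivial; then $g \mapsto i_g$, $i_g(x) = gxg^{-1}$, embeds $G$ into $\operatorname{Aut} G$, and $\operatorname{Aut} G$ is again centreless. The automorphism tower of a centreless group $G$ is the ascending chain of groups $G = G_0 \trianglelefteq G_1 \trianglelefteq \dots \trianglelefteq G_\alpha \trianglelefteq G_{\alpha+1} \trianglelefteq \dots$, indexed by the ordinals, such that $G_{\alpha+1} = \operatorname{Aut} G_\alpha$ for each ordinal $\alpha$ (where $G_\alpha$ is identified with $\operatorname{Inn} G_\alpha$ through $g \mapsto i_g$) and $G_\alpha = \bigcup_{\beta<\alpha} G_\beta$ for each limit ordinal $\alpha$. The height $\tau(G)$ of the tower is the least ordinal $\alpha$ such that $G_{\alpha+1} = G_\alpha$ (such an ordinal exists, by a theorem of Thomas). For an infinite cardinal $\kappa$, let $\tau_\kappa$ be the least ordinal such that $\tau(G) < \tau_\kappa$ for every centreless group $G$ of cardinality $\kappa$. Let $\theta$ and $\kappa$ be cardinals with $\omega \le \theta < \kappa$. Then $\tau_\theta \le \tau_\kappa$. -/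

import Mathlib

universe u

/-- `IsAutTower ι H γ` says that the subgroups `H α` (`α ≤ γ`) of the ambient group `T` form the
automorphism tower `G = G₀ ⊴ G₁ ⊴ ⋯ ⊴ G_γ` of the group `G`, written as an ascending chain
of subgroups of `T`, where `G` is identified with `G₀ = H 0` through `ι`.

At a successor step, "`G_{β+1} = Aut G_β`, with `G_β` identified with `Inn G_β`" means that `G_β`
is a normal subgroup of `G_{β+1}` and that the conjugation action `g ↦ (x ↦ g x g⁻¹)` is an
isomorphism from `G_{β+1}` onto `Aut G_β` (it sends `g ∈ G_β` to the inner automorphism `i_g`).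
For centreless `G` such a chain exists for every `γ` and is unique up to a unique isomorphism
over `G`. The values `H α` with `α > γ` play no role. -/
structure IsAutTower {G T : Type u} [Group G] [Group T] (ι : G →* T)
    (H : Ordinal.{u} → Subgroup T) (γ : Ordinal.{u}) : Prop where
  /-- `G` is identified with `G₀` -/
  injective : Function.Injective ι
  /-- `G` is identified with `G₀` -/
  zero : H 0 = ι.range
  /-- `G_β ≤ G_{β+1}` -/
  le_succ : ∀ β < γ, H β ≤ H (β + 1)
  /-- `G_β` is normal in `G_{β+1}` -/
  conj_mem : ∀ β < γ, ∀ g ∈ H (β + 1), ∀ x ∈ H β, g * x * g⁻¹ ∈ H β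
  /-- each automorphism of `G_β` is conjugation by exactly one element of `G_{β+1}` -/
  succ : ∀ β < γ, ∀ π : MulAut (H β), ∃! g : T, g ∈ H (β + 1) ∧
    ∀ x : H β, ((π x : H β) : T) = g * (x : T) * g⁻¹
  /-- `G_β` is the union of the earlier groups at limit ordinals `β` -/
  limit : ∀ β ≤ γ, Order.IsSuccLimit β → (H β : Set T) = ⋃ δ < β, (H δ : Set T)

/-- The height `τ(G)` of the automorphism tower of a centreless group `G`: the least ordinal `α`
such that `G_{α+1} = G_α`. (Such an ordinal exists for every centreless group, by the automorphism
tower theorem, so the infimum is attained.) -/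
noncomputable def autTowerHeight (G : Type u) [Group G] : Ordinal.{u} :=
  sInf {α : Ordinal.{u} | ∃ (T : Type u) (_ : Group T) (ι : G →* T)
    (H : Ordinal.{u} → Subgroup T), IsAutTower ι H (α + 1) ∧ H (α + 1) = H α}

/-- `τ_κ`: the least ordinal such that `τ(G) < τ_κ` for every centreless group `G` of
cardinality `κ`. (The groups of cardinality `κ` form a set up to isomorphism, so there is one.) -/
noncomputable def autTowerBound (κ : Cardinal.{u}) : Ordinal.{u} :=
  sInf {σ : Ordinal.{u} | ∀ (G : Type u) [Group G],
    Subgroup.center G = ⊥ → Cardinal.mk G = κ → autTowerHeight G < σ}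

/-! Given a centreless `G` of cardinality `θ`, let `S` be the finitary alternating group on `κ`
points: simple, centreless, of cardinality `κ`. Then `G × S` is centreless of cardinality `κ`, so it
suffices that `τ(G) ≤ τ(G × S)` (`autTowerHeight_le_prod`).

The tower of `G × S` is `G × Inn S` followed by `G_β × Aut S` for `β > 0` (`IsAutTower.prod`),
because every automorphism of such a term is a product (`exists_mulAut_prod`). The only obstruction
would be a normal copy of `S` in `G_β`; by `IsAutTower.range_le_zero` such a copy would already lie
in `G`, which is too small. Hence the product tower cannot stop before the tower of `G`. As heights
refer to arbitrary realisations, `IsAutTower.eq_of_eq` transfers termination from one realisation to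
another. -/

namespace IsAutTower

/-! ### Basic properties of the terms of a tower. -/

variable {G T : Type u} [Group G] [Group T] {ι : G →* T} {H : Ordinal.{u} → Subgroup T}
  {γ : Ordinal.{u}}

theorem restrict (h : IsAutTower ι H γ) {δ : Ordinal.{u}} (hδ : δ ≤ γ) : IsAutTower ι H δ where
  injective := h.injective
  zero := h.zero
  le_succ β hβ := h.le_succ β (hβ.trans_le hδ)
  conj_mem β hβ := h.conj_mem β (hβ.trans_le hδ)
  succ β hβ := h.succ β (hβ.trans_le hδ)
  limit β hβ := h.limit β (hβ.trans hδ)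

theorem comp_equiv {G' : Type u} [Group G'] (h : IsAutTower ι H γ) (e : G' ≃* G) :
    IsAutTower (ι.comp e.toMonoidHom) H γ where
  injective := h.injective.comp e.injective
  zero := by
    rw [h.zero]
    ext x
    simp only [MonoidHom.mem_range, MonoidHom.comp_apply]
    exact (e.surjective.exists (p := fun g => ι g = x))
  le_succ := h.le_succ
  conj_mem := h.conj_mem
  succ := h.succ
  limit := h.limit

theorem exists_lt_mem (h : IsAutTower ι H γ) {β : Ordinal.{u}} (hβ : β ≤ γ)
    (hl : Order.IsSuccLimit β) {x : T} (hx : x ∈ H β) : ∃ δ < β, x ∈ H δ := by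
  have : x ∈ (H β : Set T) := hx
  rw [h.limit β hβ hl] at this
  simpa using this

theorem mono (h : IsAutTower ι H γ) {β δ : Ordinal.{u}} (hβδ : β ≤ δ) (hδ : δ ≤ γ) :
    H β ≤ H δ := by
  induction δ using Ordinal.limitRecOn with
  | zero => rw [nonpos_iff_eq_zero.1 hβδ]
  | add_one δ ih =>
    rcases hβδ.eq_or_lt with rfl | hlt
    · exact le_rfl
    · have hδγ : δ < γ := (lt_add_one δ).trans_le hδ
      exact (ih (Order.lt_add_one_iff.1 hlt) hδγ.le).trans (h.le_succ δ hδγ)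
  | limit δ hl _ =>
    rcases hβδ.eq_or_lt with rfl | hlt
    · exact le_rfl
    · intro x hx
      have : x ∈ (H δ : Set T) := by
        rw [h.limit δ hδ hl]
        exact Set.mem_biUnion (show β ∈ {ε | ε < δ} from hlt) hx
      exact this

theorem eq_one_of_commute (h : IsAutTower ι H γ) {β : Ordinal.{u}} (hβ : β < γ) {g : T}
    (hg : g ∈ H (β + 1)) (hc : ∀ x ∈ H β, g * x = x * g) : g = 1 := by
  refine (h.succ β hβ 1).unique ⟨hg, fun x => ?_⟩ ⟨one_mem _, fun x => ?_⟩
  · rw [hc x x.2]; simp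
  · simp

theorem center_eq_bot (h : IsAutTower ι H γ) {β : Ordinal.{u}} (hβ : β < γ) :
    Subgroup.center (H β) = ⊥ := by
  rw [Subgroup.eq_bot_iff_forall]
  intro x hx
  rw [Subgroup.mem_center_iff] at hx
  refine Subtype.ext (h.eq_one_of_commute hβ (h.le_succ β hβ x.2) fun y hy => ?_)
  exact (congrArg Subtype.val (hx ⟨y, hy⟩)).symm

/-- A nontrivial normal subgroup of a term of the tower meets the base group. -/
theorem exists_mem_zero (h : IsAutTower ι H γ) {δ : Ordinal.{u}} (hδ : δ ≤ γ) {N : Subgroup T}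
    (hN : N ≤ H δ) (hconj : ∀ g ∈ H δ, ∀ n ∈ N, g * n * g⁻¹ ∈ N) (hne : N ≠ ⊥) :
    ∃ n ∈ N, n ∈ H 0 ∧ n ≠ 1 := by
  obtain ⟨n₀, hn₀, hn₀1⟩ := N.bot_or_exists_ne_one.resolve_left hne
  have hex : ∃ ε, ε ≤ δ ∧ ∃ n ∈ N, n ∈ H ε ∧ n ≠ 1 := ⟨δ, le_rfl, n₀, hn₀, hN hn₀, hn₀1⟩
  obtain ⟨ε, ⟨hεδ, n, hn, hnε, hn1⟩, hmin⟩ := WellFounded.has_min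
    (wellFounded_lt : WellFounded ((· < ·) : Ordinal.{u} → Ordinal.{u} → Prop))
    {ε | ε ≤ δ ∧ ∃ n ∈ N, n ∈ H ε ∧ n ≠ 1} hex
  rcases Ordinal.zero_or_succ_or_isSuccLimit ε with rfl | ⟨ζ, rfl⟩ | hl
  · exact ⟨n, hn, hnε, hn1⟩
  · simp only [Order.succ_eq_add_one] at *
    have hζδ : ζ < δ := (lt_add_one ζ).trans_le hεδ
    refine absurd (h.eq_one_of_commute (hζδ.trans_le hδ) hnε fun x hx => ?_) hn1
    by_contra hne
    -- `N` is normalised by `x` and `H ζ` by `n`, so the commutator lies in `N ∩ H ζ`, against the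
    -- minimality of `ζ + 1`.
    refine hmin ζ ⟨hζδ.le, n * x * n⁻¹ * x⁻¹, ?_, ?_, ?_⟩ (lt_add_one ζ)
    · have := hconj x (h.mono hζδ.le hδ hx) _ (inv_mem hn)
      simpa [mul_assoc] using mul_mem hn this
    · exact mul_mem (h.conj_mem ζ (hζδ.trans_le hδ) n hnε x hx) (inv_mem hx)
    · intro e
      apply hne
      rw [mul_inv_eq_one, mul_inv_eq_iff_eq_mul] at e
      exact e
  · obtain ⟨ζ, hζ, hnζ⟩ := h.exists_lt_mem (hεδ.trans hδ) hl hnε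
    exact absurd hζ (hmin ζ ⟨hζ.le.trans hεδ, n, hn, hnζ, hn1⟩)

end IsAutTower

/-! ### Normal locally simple subgroups of the terms. -/

/-- Any two elements lie in a common finitely generated simple subgroup. -/
def IsLocallyFGSimple (S : Type*) [Group S] : Prop :=
  ∀ g s : S, ∃ F : Subgroup S, F.FG ∧ IsSimpleGroup F ∧ g ∈ F ∧ s ∈ F

theorem IsLocallyFGSimple.normal_eq {S : Type*} [Group S] (hS : IsLocallyFGSimple S)
    (N : Subgroup S) (hN : N.Normal) : N = ⊥ ∨ N = ⊤ := by
  by_contra! hne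
  obtain ⟨⟨g, hgN⟩, hg1⟩ := Subgroup.ne_bot_iff_exists_ne_one.1 hne.1
  refine hne.2 ((Subgroup.eq_top_iff' N).2 fun s => ?_)
  obtain ⟨F, -, hF, hgF, hsF⟩ := hS g s
  rcases hF.eq_bot_or_eq_top_of_normal (N.subgroupOf F) inferInstance with hb | ht
  · have : (⟨g, hgF⟩ : F) ∈ N.subgroupOf F := hgN
    rw [hb, Subgroup.mem_bot] at this
    exact (hg1 (Subtype.ext (congrArg (fun x : F => (x : S)) this))).elim
  · have : (⟨s, hsF⟩ : F) ∈ N.subgroupOf F := ht ▸ Subgroup.mem_top _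
    exact this

/-- A nontrivial image contains some `φ g ≠ 1` in `H 0`. For a finitely generated simple `F`
containing `g`, the least `ε` with `φ F ≤ H ε` is not a limit, by finite generation, and not a
successor `ζ + 1`, since the preimage of `H ζ` in `F` is normal and contains `g`. -/
theorem IsAutTower.range_le_zero {G T S : Type u} [Group G] [Group T] [Group S] {ι : G →* T}
    {H : Ordinal.{u} → Subgroup T} {γ : Ordinal.{u}} (h : IsAutTower ι H γ)
    (hS : IsLocallyFGSimple S) {δ : Ordinal.{u}} (hδ : δ ≤ γ) (φ : S →* T)
    (hle : φ.range ≤ H δ)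
    (hconj : ∀ g ∈ H δ, ∀ n ∈ φ.range, g * n * g⁻¹ ∈ φ.range) : φ.range ≤ H 0 := by
  by_cases hbot : φ.range = ⊥
  · rw [hbot]; exact bot_le
  obtain ⟨-, ⟨g, rfl⟩, hg0, hg1⟩ := h.exists_mem_zero hδ hle hconj hbot
  rintro - ⟨s, rfl⟩
  obtain ⟨F, hFG, hF, hgF, hsF⟩ := hS g s
  suffices hmap : F ≤ (H 0).comap φ from hmap hsF
  obtain ⟨ε, ⟨hεδ, hFε⟩, hmin⟩ := WellFounded.has_min
    (wellFounded_lt : WellFounded ((· < ·) : Ordinal.{u} → Ordinal.{u} → Prop))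
    {ε | ε ≤ δ ∧ F ≤ (H ε).comap φ} ⟨δ, le_rfl, fun x _ => hle ⟨x, rfl⟩⟩
  rcases Ordinal.zero_or_succ_or_isSuccLimit ε with rfl | ⟨ζ, rfl⟩ | hl
  · exact hFε
  · exfalso
    simp only [Order.succ_eq_add_one] at *
    have hζδ : ζ < δ := (lt_add_one ζ).trans_le hεδ
    refine hmin ζ ⟨hζδ.le, ?_⟩ (lt_add_one ζ)
    have hnormal : (((H ζ).comap φ).subgroupOf F).Normal := by
      refine ⟨fun n hn f => ?_⟩
      have := h.conj_mem ζ (hζδ.trans_le hδ) (φ f) (hFε f.2) (φ n) hn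
      simpa [Subgroup.mem_subgroupOf] using this
    rcases hF.eq_bot_or_eq_top_of_normal _ hnormal with hb | ht
    · have : (⟨g, hgF⟩ : F) ∈ ((H ζ).comap φ).subgroupOf F :=
        h.mono bot_le (hζδ.le.trans hδ) hg0
      rw [hb, Subgroup.mem_bot] at this
      exact absurd (by rw [show g = 1 from congrArg Subtype.val this, map_one]) hg1
    · exact Subgroup.subgroupOf_eq_top.1 ht
  · exfalso
    obtain ⟨X, hX⟩ := hFG
    have hsub : ∀ x ∈ X, ∃ ζ < ε, φ x ∈ H ζ := fun x hx =>
      h.exists_lt_mem (hεδ.trans hδ) hl (hFε (hX ▸ Subgroup.subset_closure hx))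
    choose! f hf hfmem using hsub
    have hsup : X.sup f < ε := (Finset.sup_lt_iff hl.bot_lt).2 hf
    refine hmin _ ⟨hsup.le.trans hεδ, ?_⟩ hsup
    rw [← hX, Subgroup.closure_le]
    exact fun x hx => h.mono (Finset.le_sup hx) (hsup.le.trans (hεδ.trans hδ)) (hfmem x hx)

/-! ### Automorphisms of `P × A` with `Inn S ≤ A ≤ Aut S`. -/

section ProductAutomorphisms

variable {P S : Type*} [Group P] [Group S] {A : Subgroup (MulAut S)}

/-- The group `S` as the subgroup of inner automorphisms in the second factor of `P × A`. -/
def innerInr (P : Type*) [Group P] (hA : (MulAut.conj (G := S)).range ≤ A) : S →* P × A :=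
  (MonoidHom.inr P A).comp ((Subgroup.inclusion hA).comp (MulAut.conj (G := S)).rangeRestrict)

variable (hA : (MulAut.conj (G := S)).range ≤ A)

@[simp]
theorem innerInr_fst (s : S) : (innerInr P hA s).1 = 1 := rfl

@[simp]
theorem innerInr_snd (s : S) : ((innerInr P hA s).2 : MulAut S) = MulAut.conj s := rfl

theorem mulAut_mul_conj_mul_inv (c : MulAut S) (s : S) :
    c * MulAut.conj s * c⁻¹ = MulAut.conj (c s) := by
  ext t
  simp

theorem conj_innerInr (x : P × A) (s : S) :
    x * innerInr P hA s * x⁻¹ = innerInr P hA ((x.2 : MulAut S) s) := by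
  refine Prod.ext (by simp) (Subtype.ext ?_)
  exact mulAut_mul_conj_mul_inv _ _

theorem conj_injective_of_center (hZ : Subgroup.center S = ⊥) :
    Function.Injective (MulAut.conj (G := S)) := by
  rw [injective_iff_map_eq_one]
  intro s hs
  have : s ∈ Subgroup.center S := by
    rw [Subgroup.mem_center_iff]
    intro t
    have := DFunLike.congr_fun hs t
    rw [MulAut.conj_apply, mul_inv_eq_iff_eq_mul] at this
    exact this.symm
  rwa [hZ, Subgroup.mem_bot] at this

theorem innerInr_injective (hZ : Subgroup.center S = ⊥) :
    Function.Injective (innerInr P hA) := fun s t h =>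
  conj_injective_of_center hZ (by
    rw [← innerInr_snd (P := P) hA s, h, innerInr_snd])

theorem snd_eq_one_of_commute (hZ : Subgroup.center S = ⊥) (x : P × A)
    (hx : ∀ s, x * innerInr P hA s = innerInr P hA s * x) : x.2 = 1 := by
  refine Subtype.ext (MulEquiv.ext fun s => innerInr_injective (P := P) hA hZ ?_)
  rw [← conj_innerInr, hx]
  simp

/-- The copy of `S` and its image under `π` are both normal. If they meet nontrivially, simplicity
puts the image inside the copy. Otherwise they commute, so the image has trivial second coordinate
and embeds as a normal subgroup of `P`, contrary to `hP`. -/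
theorem map_innerInr_mem_range (hZ : Subgroup.center S = ⊥)
    (hS : ∀ N : Subgroup S, N.Normal → N = ⊥ ∨ N = ⊤)
    (hP : ∀ φ : S →* P, Function.Injective φ → ¬ φ.range.Normal) (π : MulAut (P × A)) (s : S) :
    ∃ t, π (innerInr P hA s) = innerInr P hA t := by
  set i := innerInr P hA with hi
  have hnorm : i.range.Normal := ⟨by
    rintro - ⟨s, rfl⟩ x
    exact ⟨_, (conj_innerInr hA x s).symm⟩⟩
  have hconj : ∀ (x : P × A) (s : S), ∃ t, x * π (i s) * x⁻¹ = π (i t) := fun x s =>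
    ⟨((π.symm x).2 : MulAut S) s, by rw [hi, ← conj_innerInr, ← hi]; simp⟩
  rcases hS (i.range.comap (π.toMonoidHom.comp i)) inferInstance with hb | ht
  · exfalso
    have hcomm : ∀ s t, π (i s) * i t = i t * π (i s) := by
      intro s t
      obtain ⟨r, hr⟩ := hconj (i t) s⁻¹
      have h1 : π (i s) * i t * (π (i s))⁻¹ * (i t)⁻¹ = π (i (s * r)) := by
        rw [map_mul, map_mul, ← hr, map_inv, map_inv]
        group
      have h2 : s * r ∈ i.range.comap (π.toMonoidHom.comp i) := by
        change π (i (s * r)) ∈ i.range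
        rw [← h1]
        exact mul_mem (hnorm.conj_mem _ ⟨t, rfl⟩ _) (inv_mem ⟨t, rfl⟩)
      rw [hb, Subgroup.mem_bot] at h2
      rw [h2, map_one, map_one, mul_inv_eq_one, mul_inv_eq_iff_eq_mul] at h1
      exact h1
    have hsnd : ∀ s, (π (i s)).2 = 1 := fun s => snd_eq_one_of_commute hA hZ _ (hcomm s)
    refine hP ((MonoidHom.fst P A).comp (π.toMonoidHom.comp i)) (fun s t hst => ?_) ⟨?_⟩
    · refine innerInr_injective (P := P) hA hZ (π.injective (Prod.ext hst ?_))
      exact (hsnd s).trans (hsnd t).symm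
    · rintro - ⟨s, rfl⟩ p
      obtain ⟨t, ht⟩ := hconj (p, 1) s
      exact ⟨t, (congrArg Prod.fst ht).symm⟩
  · have : s ∈ i.range.comap (π.toMonoidHom.comp i) := ht ▸ Subgroup.mem_top _
    obtain ⟨t, ht⟩ := this
    exact ⟨t, ht.symm⟩

/-- If `S` is centreless and simple and does not embed as a normal subgroup of the centreless
group `P`, then automorphisms of `P × A`, where `Inn S ≤ A ≤ Aut S`, are products. -/
theorem exists_mulAut_prod (hA : (MulAut.conj (G := S)).range ≤ A)
    (hPZ : Subgroup.center P = ⊥) (hZ : Subgroup.center S = ⊥)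
    (hS : ∀ N : Subgroup S, N.Normal → N = ⊥ ∨ N = ⊤)
    (hP : ∀ φ : S →* P, Function.Injective φ → ¬ φ.range.Normal) (π : MulAut (P × A)) :
    ∃ (ρ : MulAut P) (a : MulAut S), ∀ x : P × A,
      (π x).1 = ρ x.1 ∧ ((π x).2 : MulAut S) = a * x.2 * a⁻¹ := by
  have hinj := innerInr_injective (P := P) hA hZ
  set i := innerInr P hA with hi
  choose f hf using map_innerInr_mem_range hA hZ hS hP π
  choose f' hf' using map_innerInr_mem_range hA hZ hS hP π.symm
  rw [← hi] at hf hf'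
  let a : MulAut S :=
    { toFun := f
      invFun := f'
      left_inv := fun s => hinj (by rw [← hf', ← hf, MulEquiv.symm_apply_apply])
      right_inv := fun s => hinj (by rw [← hf, ← hf', MulEquiv.apply_symm_apply])
      map_mul' := fun s t => hinj (by rw [← hf, map_mul, map_mul, map_mul, hf, hf]) }
  have ha : ∀ s, π (i s) = i (a s) := hf
  have ha' : ∀ s, π.symm (i s) = i (a.symm s) := hf'
  -- `P × 1` centralises the copy of `S`, hence so does its image. The general `σ` covers both `π`
  -- and `π.symm`.
  have hleft : ∀ (σ : MulAut (P × A)) (b : MulAut S), (∀ s, σ (i s) = i (b s)) →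
      ∀ p : P, (σ (p, 1)).2 = 1 := by
    intro σ b hb p
    refine snd_eq_one_of_commute hA hZ _ fun s => ?_
    obtain ⟨t, rfl⟩ := b.surjective s
    rw [← hi, ← hb, ← map_mul, ← map_mul]
    congr 1
    exact Prod.ext (by simp [hi]) (by simp)
  have hπ : ∀ p, π (p, 1) = ((π (p, 1)).1, 1) := fun p => Prod.ext rfl (hleft π a ha p)
  have hπ' : ∀ p, π.symm (p, 1) = ((π.symm (p, 1)).1, 1) := fun p =>
    Prod.ext rfl (hleft π.symm a.symm ha' p)
  let ρ : MulAut P :=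
    { toFun := fun p => (π (p, 1)).1
      invFun := fun p => (π.symm (p, 1)).1
      left_inv := fun p => by
        change (π.symm ((π (p, 1)).1, 1)).1 = p
        rw [← hπ, MulEquiv.symm_apply_apply]
      right_inv := fun p => by
        change (π ((π.symm (p, 1)).1, 1)).1 = p
        rw [← hπ', MulEquiv.apply_symm_apply]
      map_mul' := fun p q => by
        rw [← Prod.fst_mul, ← map_mul]; simp }
  have hρ : ∀ p, π (p, 1) = (ρ p, 1) := hπ
  -- `1 × A` commutes with `P × 1`, which `π` maps onto itself, so this coordinate is central in
  -- `P`.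
  have hfst : ∀ c : A, (π (1, c)).1 = 1 := by
    intro c
    have : (π (1, c)).1 ∈ Subgroup.center P := by
      rw [Subgroup.mem_center_iff]
      intro q
      obtain ⟨p, rfl⟩ := ρ.surjective q
      have h : π (p, 1) * π (1, c) = π (1, c) * π (p, 1) := by
        rw [← map_mul, ← map_mul]; simp
      rw [hρ] at h
      exact congrArg Prod.fst h
    rwa [hPZ, Subgroup.mem_bot] at this
  have hsnd : ∀ c : A, ((π (1, c)).2 : MulAut S) = a * c * a⁻¹ := by
    intro c
    rw [eq_mul_inv_iff_mul_eq]
    refine MulEquiv.ext fun s => hinj ?_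
    have h : π (1, c) * π (i s) * (π (1, c))⁻¹ = π (i ((c : MulAut S) s)) := by
      rw [hi, ← conj_innerInr hA (1, c) s, map_mul, map_mul, map_inv]
    rw [ha, ha, hi, conj_innerInr] at h
    exact h
  refine ⟨ρ, a, fun x => ?_⟩
  have hx : π x = π (x.1, 1) * π (1, x.2) := by rw [← map_mul]; simp
  rw [hx, hρ]
  exact ⟨by simp [hfst], by simpa using hsnd x.2⟩

end ProductAutomorphisms

/-! ### The tower of a product. -/

/-- The terms of the automorphism tower of `G × S` for simple `S`. -/
noncomputable def prodTower {T : Type u} [Group T] (H : Ordinal.{u} → Subgroup T) (S : Type u)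
    [Group S] (β : Ordinal.{u}) : Subgroup (T × MulAut S) :=
  open Classical in
  (H β).prod (if β = 0 then (MulAut.conj (G := S)).range else ⊤)

section ProdTower

variable {G T S : Type u} [Group G] [Group T] [Group S] {ι : G →* T}
  {H : Ordinal.{u} → Subgroup T} {γ : Ordinal.{u}}

theorem prodTower_zero : prodTower H S 0 = (H 0).prod (MulAut.conj (G := S)).range := by
  simp [prodTower]

theorem prodTower_of_ne_zero {β : Ordinal.{u}} (hβ : β ≠ 0) :
    prodTower H S β = (H β).prod ⊤ := by
  simp [prodTower, hβ]

theorem exists_prodTower_eq (H : Ordinal.{u} → Subgroup T) (S : Type u) [Group S]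
    (β : Ordinal.{u}) : ∃ A : Subgroup (MulAut S), (MulAut.conj (G := S)).range ≤ A ∧ A.Normal ∧
      prodTower H S β = (H β).prod A := by
  by_cases hβ : β = 0
  · subst hβ
    refine ⟨_, le_rfl, ⟨?_⟩, prodTower_zero⟩
    rintro - ⟨s, rfl⟩ c
    exact ⟨c s, (mulAut_mul_conj_mul_inv c s).symm⟩
  · exact ⟨⊤, le_top, inferInstance, prodTower_of_ne_zero hβ⟩

theorem mem_prodTower_add_one {β : Ordinal.{u}} {x : T × MulAut S} :
    x ∈ prodTower H S (β + 1) ↔ x.1 ∈ H (β + 1) := by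
  rw [prodTower_of_ne_zero (by simp), Subgroup.mem_prod]
  simp

/-- At a successor an automorphism splits as `ρ` on `H β` and conjugation by some `a : MulAut S`;
the tower of `G` realises `ρ` by a unique element, and `a` is determined by its action on `Inn S`.
-/
theorem IsAutTower.prod (h : IsAutTower ι H γ) (hS : IsLocallyFGSimple S)
    (hZ : Subgroup.center S = ⊥) (hcard : Cardinal.mk G < Cardinal.mk S) :
    IsAutTower (ι.prodMap (MulAut.conj (G := S))) (prodTower H S) γ where
  injective := Prod.map_injective.2 ⟨h.injective, conj_injective_of_center hZ⟩
  zero := by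
    rw [prodTower_zero, h.zero, MonoidHom.range_prodMap]
  le_succ β hβ := by
    intro x hx
    obtain ⟨A, -, -, hA⟩ := exists_prodTower_eq H S β
    rw [hA, Subgroup.mem_prod] at hx
    exact mem_prodTower_add_one.2 (h.le_succ β hβ hx.1)
  conj_mem β hβ := by
    intro g hg x hx
    obtain ⟨A, -, hAn, hA⟩ := exists_prodTower_eq H S β
    rw [hA, Subgroup.mem_prod] at hx ⊢
    exact ⟨h.conj_mem β hβ _ (mem_prodTower_add_one.1 hg) _ hx.1, hAn.conj_mem _ hx.2 _⟩
  succ β hβ := by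
    obtain ⟨A, hle, -, hA⟩ := exists_prodTower_eq H S β
    rw [hA]
    intro π
    have hno : ∀ φ : S →* H β, Function.Injective φ → ¬ φ.range.Normal := by
      intro φ hφ hn
      have hr : ((H β).subtype.comp φ).range ≤ H 0 := by
        refine h.range_le_zero hS hβ.le _ ?_ ?_
        · rintro - ⟨s, rfl⟩
          exact (φ s).2
        · rintro g hg - ⟨s, rfl⟩
          obtain ⟨t, ht⟩ := hn.conj_mem (φ s) ⟨s, rfl⟩ ⟨g, hg⟩
          exact ⟨t, congrArg Subtype.val ht⟩
      rw [h.zero] at hr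
      have hpre : ∀ s, ∃ g, ι g = φ s := fun s => hr ⟨s, rfl⟩
      choose f hf using hpre
      refine hcard.not_ge (Cardinal.mk_le_of_injective (f := f) fun s t hst => hφ ?_)
      exact Subtype.ext (by rw [← hf, ← hf, hst])
    obtain ⟨ρ, a, hρa⟩ := exists_mulAut_prod hle (h.center_eq_bot hβ) hZ hS.normal_eq hno
      ((Subgroup.prodEquiv (H β) A).symm.trans (π.trans (Subgroup.prodEquiv (H β) A)))
    have hπ : ∀ x : (H β).prod A, ((π x : (H β).prod A) : T × MulAut S) =
        (((ρ ⟨x.1.1, x.2.1⟩ : H β) : T), a * x.1.2 * a⁻¹) := fun x =>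
      Prod.ext (congrArg Subtype.val (hρa (Subgroup.prodEquiv _ _ x)).1)
        (hρa (Subgroup.prodEquiv _ _ x)).2
    obtain ⟨g, ⟨hg, hgρ⟩, huniq⟩ := h.succ β hβ ρ
    refine ⟨(g, a), ⟨mem_prodTower_add_one.2 hg, fun x => ?_⟩, ?_⟩
    · rw [hπ, hgρ]
      rfl
    · rintro ⟨g', b⟩ ⟨hg', hb⟩
      refine Prod.ext (huniq g' ⟨mem_prodTower_add_one.1 hg', fun x => ?_⟩) ?_
      · have := hb ⟨(x, 1), x.2, one_mem _⟩
        rw [hπ] at this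
        exact congrArg Prod.fst this
      · refine MulEquiv.ext fun s => conj_injective_of_center hZ ?_
        have := hb ⟨(1, MulAut.conj s), one_mem _, hle ⟨s, rfl⟩⟩
        rw [hπ] at this
        have h2 := congrArg Prod.snd this
        simp only [Prod.snd_mul, Prod.snd_inv, mulAut_mul_conj_mul_inv] at h2
        exact h2.symm
  limit β hβ hl := by
    have h0 : β ≠ 0 := hl.bot_lt.ne'
    ext x
    simp only [Set.mem_iUnion, SetLike.mem_coe, exists_prop]
    rw [prodTower_of_ne_zero h0, Subgroup.mem_prod]
    constructor
    · rintro ⟨hx, -⟩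
      obtain ⟨δ, hδ, hxδ⟩ := h.exists_lt_mem hβ hl hx
      -- The index `δ` may be `0`, where the second factor is only `Inn S`; passing to `δ + 1` makes
      -- it all of `Aut S`.
      have hδ1 := hl.add_one_lt hδ
      exact ⟨δ + 1, hδ1, mem_prodTower_add_one.2
        (h.mono (lt_add_one δ).le (hδ1.le.trans hβ) hxδ)⟩
    · rintro ⟨δ, hδ, hx⟩
      obtain ⟨A, -, -, hA⟩ := exists_prodTower_eq H S δ
      rw [hA, Subgroup.mem_prod] at hx
      exact ⟨h.mono hδ.le hβ hx.1, Subgroup.mem_top _⟩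

end ProdTower

/-! ### Uniqueness of the tower over its base. -/

/-- `R` is the graph of an isomorphism between the subgroups `K₁` and `K₂`. -/
structure IsIsoGraph {T₁ T₂ : Type*} [Group T₁] [Group T₂] (R : Set (T₁ × T₂))
    (K₁ : Subgroup T₁) (K₂ : Subgroup T₂) : Prop where
  mul_mem {p q} : p ∈ R → q ∈ R → p * q ∈ R
  fst_mem {p} : p ∈ R → p.1 ∈ K₁
  snd_mem {p} : p ∈ R → p.2 ∈ K₂
  existsUnique_snd : ∀ x ∈ K₁, ∃! y, (x, y) ∈ R
  existsUnique_fst : ∀ y ∈ K₂, ∃! x, (x, y) ∈ R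

namespace IsIsoGraph

variable {T₁ T₂ : Type*} [Group T₁] [Group T₂] {R : Set (T₁ × T₂)}
  {K₁ : Subgroup T₁} {K₂ : Subgroup T₂}

theorem swap (h : IsIsoGraph R K₁ K₂) : IsIsoGraph (Prod.swap ⁻¹' R) K₂ K₁ where
  mul_mem hp hq := h.mul_mem hp hq
  fst_mem hp := h.snd_mem hp
  snd_mem hp := h.fst_mem hp
  existsUnique_snd := h.existsUnique_fst
  existsUnique_fst := h.existsUnique_snd

theorem exists_mulEquiv (h : IsIsoGraph R K₁ K₂) :
    ∃ e : K₁ ≃* K₂, (∀ x : K₁, ((x : T₁), (e x : T₂)) ∈ R) ∧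
      ∀ p ∈ R, ∃ x : K₁, p = ((x : T₁), (e x : T₂)) := by
  choose f hf hfu using fun x : K₁ => h.existsUnique_snd x x.2
  choose k hk hku using fun y : K₂ => h.existsUnique_fst y y.2
  refine ⟨{ toFun := fun x => ⟨f x, h.snd_mem (hf x)⟩
            invFun := fun y => ⟨k y, h.fst_mem (hk y)⟩
            left_inv := fun x => Subtype.ext (hku _ _ (hf x)).symm
            right_inv := fun y => Subtype.ext (hfu _ _ (hk y)).symm
            map_mul' := fun x y => Subtype.ext
              (hfu (x * y) _ (h.mul_mem (hf x) (hf y))).symm }, hf, fun p hp => ?_⟩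
  exact ⟨⟨p.1, h.fst_mem hp⟩, Prod.ext rfl (hfu ⟨p.1, h.fst_mem hp⟩ p.2 hp)⟩

theorem inv_mem (h : IsIsoGraph R K₁ K₂) {p : T₁ × T₂} (hp : p ∈ R) : p⁻¹ ∈ R := by
  obtain ⟨e, he, hR⟩ := h.exists_mulEquiv
  obtain ⟨x, rfl⟩ := hR p hp
  simpa using he x⁻¹

end IsIsoGraph

theorem IsAutTower.exists_mulAut_conj {G T : Type u} [Group G] [Group T] {ι : G →* T}
    {H : Ordinal.{u} → Subgroup T} {γ : Ordinal.{u}} (h : IsAutTower ι H γ) {β : Ordinal.{u}}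
    (hβ : β < γ) {g : T} (hg : g ∈ H (β + 1)) :
    ∃ c : MulAut (H β), ∀ x : H β, ((c x : H β) : T) = g * x * g⁻¹ :=
  ⟨{ toFun := fun x => ⟨g * x * g⁻¹, h.conj_mem β hβ g hg x x.2⟩
     invFun := fun x => ⟨g⁻¹ * x * g⁻¹⁻¹, h.conj_mem β hβ _ (inv_mem hg) x x.2⟩
     left_inv := fun x => Subtype.ext (by simp [mul_assoc])
     right_inv := fun x => Subtype.ext (by simp [mul_assoc])
     map_mul' := fun x y => Subtype.ext (by simp) }, fun _ => rfl⟩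

theorem IsAutTower.existsUnique_of_limit {G T₁ : Type u} {T₂ : Type*} [Group G] [Group T₁]
    {ι₁ : G →* T₁} {H₁ : Ordinal.{u} → Subgroup T₁} {γ : Ordinal.{u}} (h₁ : IsAutTower ι₁ H₁ γ) {δ : Ordinal.{u}} (hδ : δ ≤ γ)
    (hl : Order.IsSuccLimit δ) {D : Ordinal.{u} → Set (T₁ × T₂)}
    (hmono : ∀ ε < δ, ∀ ζ ≤ ε, D ζ ⊆ D ε)
    (hD : ∀ ε < δ, ∀ x ∈ H₁ ε, ∃! y, (x, y) ∈ D ε) {x : T₁} (hx : x ∈ H₁ δ) :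
    ∃! y, ∃ ε < δ, (x, y) ∈ D ε := by
  obtain ⟨ε, hε, hxε⟩ := h₁.exists_lt_mem hδ hl hx
  obtain ⟨y, hy, -⟩ := hD ε hε x hxε
  refine ⟨y, ⟨ε, hε, hy⟩, ?_⟩
  rintro z ⟨ζ, hζ, hz⟩
  have hm : max ε ζ < δ := max_lt hε hζ
  exact (hD _ hm x (h₁.mono (le_max_left _ _) (hm.le.trans hδ) hxε)).unique
    (hmono _ hm ζ (le_max_right _ _) hz) (hmono _ hm ε (le_max_left _ _) hy)

section TowerGraph

variable {G T₁ T₂ : Type u} [Group G] [Group T₁] [Group T₂] {ι₁ : G →* T₁} {ι₂ : G →* T₂}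
  {H₁ : Ordinal.{u} → Subgroup T₁} {H₂ : Ordinal.{u} → Subgroup T₂} {γ : Ordinal.{u}}

/-- The pairs in `K₁ × K₂` that normalise `R`. -/
def normalizingPairs (R : Set (T₁ × T₂)) (K₁ : Subgroup T₁) (K₂ : Subgroup T₂) :
    Set (T₁ × T₂) :=
  {p | p.1 ∈ K₁ ∧ p.2 ∈ K₂ ∧ ∀ x ∈ R, p * x * p⁻¹ ∈ R}

/-- Conjugation by `g`, transported along the isomorphism with graph `R`, is an automorphism of `H₂
β`, hence conjugation by exactly one `g'`; normalising `R` expresses this correspondence. -/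
theorem existsUnique_normalizingPairs (h₁ : IsAutTower ι₁ H₁ γ) (h₂ : IsAutTower ι₂ H₂ γ)
    {β : Ordinal.{u}} (hβ : β < γ) {R : Set (T₁ × T₂)} (hR : IsIsoGraph R (H₁ β) (H₂ β))
    {g : T₁} (hg : g ∈ H₁ (β + 1)) :
    ∃! g', (g, g') ∈ normalizingPairs R (H₁ (β + 1)) (H₂ (β + 1)) := by
  obtain ⟨e, he, heR⟩ := hR.exists_mulEquiv
  obtain ⟨c, hc⟩ := h₁.exists_mulAut_conj hβ hg
  obtain ⟨g', ⟨hg', hπ⟩, huniq⟩ := h₂.succ β hβ (e.symm.trans (c.trans e))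
  have hπ' : ∀ x, ((e (c x) : H₂ β) : T₂) = g' * e x * g'⁻¹ := fun x => by simpa using hπ (e x)
  refine ⟨g', ⟨hg, hg', fun p hp => ?_⟩, ?_⟩
  · obtain ⟨x, rfl⟩ := heR p hp
    have := he (c x)
    rwa [hc, hπ'] at this
  · rintro k ⟨-, hk, hkR⟩
    refine huniq k ⟨hk, fun y => ?_⟩
    obtain ⟨x, rfl⟩ := e.surjective y
    have h1 := hkR _ (he x)
    have h2 := he (c x)
    rw [hc] at h2
    have h3 := (hR.existsUnique_snd (g * x * g⁻¹) (hc x ▸ (c x).2)).unique h2 h1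
    simpa using h3

theorem isIsoGraph_normalizingPairs (h₁ : IsAutTower ι₁ H₁ γ) (h₂ : IsAutTower ι₂ H₂ γ)
    {β : Ordinal.{u}} (hβ : β < γ) {R : Set (T₁ × T₂)} (hR : IsIsoGraph R (H₁ β) (H₂ β)) :
    IsIsoGraph (normalizingPairs R (H₁ (β + 1)) (H₂ (β + 1))) (H₁ (β + 1)) (H₂ (β + 1)) where
  mul_mem hp hq := by
    refine ⟨mul_mem hp.1 hq.1, mul_mem hp.2.1 hq.2.1, fun x hx => ?_⟩
    simpa [mul_assoc] using hp.2.2 _ (hq.2.2 x hx)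
  fst_mem hp := hp.1
  snd_mem hp := hp.2.1
  existsUnique_snd g hg := existsUnique_normalizingPairs h₁ h₂ hβ hR hg
  existsUnique_fst g hg := by
    have := existsUnique_normalizingPairs h₂ h₁ hβ hR.swap hg
    refine (existsUnique_congr fun k => ?_).1 this
    constructor
    · rintro ⟨h1, h2, h3⟩
      exact ⟨h2, h1, fun x hx => h3 x.swap hx⟩
    · rintro ⟨h1, h2, h3⟩
      exact ⟨h2, h1, fun x hx => h3 x.swap hx⟩

/-- The graph of the isomorphism over `G` between the terms of two automorphism towers. -/
noncomputable def towerGraph (ι₁ : G →* T₁) (ι₂ : G →* T₂) (H₁ : Ordinal.{u} → Subgroup T₁)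
    (H₂ : Ordinal.{u} → Subgroup T₂) (δ : Ordinal.{u}) : Set (T₁ × T₂) :=
  Ordinal.limitRecOn (motive := fun _ => Set (T₁ × T₂)) δ (Set.range fun g => (ι₁ g, ι₂ g))
    (fun β R => normalizingPairs R (H₁ (β + 1)) (H₂ (β + 1)))
    (fun β _ R => ⋃ ε, ⋃ h : ε < β, R ε h)

theorem towerGraph_zero : towerGraph ι₁ ι₂ H₁ H₂ 0 = Set.range fun g => (ι₁ g, ι₂ g) :=
  Ordinal.limitRecOn_zero ..

theorem towerGraph_add_one (β : Ordinal.{u}) : towerGraph ι₁ ι₂ H₁ H₂ (β + 1) =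
    normalizingPairs (towerGraph ι₁ ι₂ H₁ H₂ β) (H₁ (β + 1)) (H₂ (β + 1)) :=
  Ordinal.limitRecOn_add_one ..

theorem mem_towerGraph_limit {β : Ordinal.{u}} (hl : Order.IsSuccLimit β) {p : T₁ × T₂} :
    p ∈ towerGraph ι₁ ι₂ H₁ H₂ β ↔ ∃ ε < β, p ∈ towerGraph ι₁ ι₂ H₁ H₂ ε := by
  have : towerGraph ι₁ ι₂ H₁ H₂ β = ⋃ ε, ⋃ _ : ε < β, towerGraph ι₁ ι₂ H₁ H₂ ε :=
    Ordinal.limitRecOn_limit _ _ _ _ hl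
  simp [this]

/-- All graphs are subsets of the fixed `T₁ × T₂`, so limits are plain unions; carrying monotonicity
through the induction makes these unions single-valued in both directions. -/
theorem isIsoGraph_towerGraph (h₁ : IsAutTower ι₁ H₁ γ) (h₂ : IsAutTower ι₂ H₂ γ)
    (δ : Ordinal.{u}) (hδ : δ ≤ γ) :
    IsIsoGraph (towerGraph ι₁ ι₂ H₁ H₂ δ) (H₁ δ) (H₂ δ) ∧
      ∀ ε ≤ δ, towerGraph ι₁ ι₂ H₁ H₂ ε ⊆ towerGraph ι₁ ι₂ H₁ H₂ δ := by
  induction δ using Ordinal.limitRecOn with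
  | zero =>
    refine ⟨?_, fun ε hε => by rw [nonpos_iff_eq_zero.1 hε]⟩
    rw [towerGraph_zero, h₁.zero, h₂.zero]
    constructor
    · rintro _ _ ⟨x, rfl⟩ ⟨y, rfl⟩
      exact ⟨x * y, by simp⟩
    · rintro _ ⟨x, rfl⟩
      exact ⟨x, rfl⟩
    · rintro _ ⟨x, rfl⟩
      exact ⟨x, rfl⟩
    · rintro - ⟨x, rfl⟩
      refine ⟨ι₂ x, ⟨x, rfl⟩, ?_⟩
      rintro z ⟨y, hy⟩
      rw [Prod.mk.injEq] at hy
      rw [← hy.2, h₁.injective hy.1]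
    · rintro - ⟨x, rfl⟩
      refine ⟨ι₁ x, ⟨x, rfl⟩, ?_⟩
      rintro z ⟨y, hy⟩
      rw [Prod.mk.injEq] at hy
      rw [← hy.1, h₂.injective hy.2]
  | add_one δ ih =>
    have hδγ : δ < γ := (lt_add_one δ).trans_le hδ
    obtain ⟨hR, hmono⟩ := ih hδγ.le
    refine ⟨by
      rw [towerGraph_add_one]
      exact isIsoGraph_normalizingPairs h₁ h₂ hδγ hR, fun ε hε => ?_⟩
    rcases hε.eq_or_lt with rfl | hlt
    · exact le_rfl
    · refine (hmono ε (Order.lt_add_one_iff.1 hlt)).trans fun p hp => ?_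
      rw [towerGraph_add_one]
      exact ⟨h₁.le_succ δ hδγ (hR.fst_mem hp), h₂.le_succ δ hδγ (hR.snd_mem hp),
        fun x hx => hR.mul_mem (hR.mul_mem hp hx) (hR.inv_mem hp)⟩
  | limit δ hl ih =>
    have hiso := fun ε (hε : ε < δ) => (ih ε hε (hε.le.trans hδ)).1
    have hmono := fun ε (hε : ε < δ) => (ih ε hε (hε.le.trans hδ)).2
    refine ⟨⟨?_, ?_, ?_, ?_, ?_⟩, fun ε hε p hp => ?_⟩
    · intro p q hp hq
      rw [mem_towerGraph_limit hl] at hp hq ⊢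
      obtain ⟨ε, hε, hp⟩ := hp
      obtain ⟨ζ, hζ, hq⟩ := hq
      have hm : max ε ζ < δ := max_lt hε hζ
      exact ⟨_, hm, (hiso _ hm).mul_mem (hmono _ hm _ (le_max_left _ _) hp)
        (hmono _ hm _ (le_max_right _ _) hq)⟩
    · intro p hp
      obtain ⟨ε, hε, hp⟩ := (mem_towerGraph_limit hl).1 hp
      exact h₁.mono hε.le hδ ((hiso ε hε).fst_mem hp)
    · intro p hp
      obtain ⟨ε, hε, hp⟩ := (mem_towerGraph_limit hl).1 hp
      exact h₂.mono hε.le hδ ((hiso ε hε).snd_mem hp)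
    · intro x hx
      simp only [mem_towerGraph_limit hl]
      exact h₁.existsUnique_of_limit hδ hl hmono (fun ε hε => (hiso ε hε).existsUnique_snd) hx
    · intro y hy
      simp only [mem_towerGraph_limit hl]
      exact h₂.existsUnique_of_limit (D := fun ε => Prod.swap ⁻¹' towerGraph ι₁ ι₂ H₁ H₂ ε)
        hδ hl (fun ε hε ζ hζ => Set.preimage_mono (hmono ε hε ζ hζ))
        (fun ε hε => (hiso ε hε).existsUnique_fst) hy
    · rcases hε.eq_or_lt with rfl | hlt
      · exact hp
      · exact (mem_towerGraph_limit hl).2 ⟨ε, hlt, hp⟩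

/-- Whether the tower of `G` terminates at `β` does not depend on its realisation. -/
theorem IsAutTower.eq_of_eq (h₁ : IsAutTower ι₁ H₁ γ) (h₂ : IsAutTower ι₂ H₂ γ)
    {β : Ordinal.{u}} (hβ : β < γ) (heq : H₁ (β + 1) = H₁ β) : H₂ (β + 1) = H₂ β := by
  refine le_antisymm (fun y hy => ?_) (h₂.le_succ β hβ)
  obtain ⟨hR, hmono⟩ := isIsoGraph_towerGraph h₁ h₂ (β + 1) (Order.add_one_le_of_lt hβ)
  obtain ⟨hR', -⟩ := isIsoGraph_towerGraph h₁ h₂ β hβ.le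
  obtain ⟨x, hx, -⟩ := hR.existsUnique_fst y hy
  have hx1 := hR.fst_mem hx
  obtain ⟨z, hz, -⟩ := hR'.existsUnique_snd x (heq ▸ hx1)
  rw [(hR.existsUnique_snd x hx1).unique hx (hmono β (lt_add_one β).le hz)]
  exact hR'.snd_mem hz

end TowerGraph

/-! ### The finitary alternating group. -/

section FinitaryAlternating

open Cardinal

variable (α : Type u)

open Classical in
/-- The even permutations of a finite set `s`, extended by the identity. -/
noncomputable def alternatingOn (s : Finset α) : Subgroup (Equiv.Perm α) :=
  (alternatingGroup s).map Equiv.Perm.ofSubtype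

open Classical in
theorem alternatingOn_mono : Monotone (alternatingOn α) := by
  rintro s t hst - ⟨σ, hσ, rfl⟩
  let e : s ≃ {x : t // (x : α) ∈ s} :=
    { toFun := fun x => ⟨⟨x, hst x.2⟩, x.2⟩
      invFun := fun x => ⟨x.1, x.2⟩
      left_inv := fun _ => rfl
      right_inv := fun _ => rfl }
  refine ⟨σ.extendDomain e, ?_, ?_⟩
  · rw [SetLike.mem_coe, Equiv.Perm.mem_alternatingGroup] at hσ ⊢
    rw [Equiv.Perm.sign_extendDomain, hσ]
  · ext x
    by_cases hx : x ∈ s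
    · have h1 : (σ.extendDomain e) ⟨x, hst hx⟩ = e (σ ⟨x, hx⟩) :=
        Equiv.Perm.extendDomain_apply_image σ e ⟨x, hx⟩
      rw [Equiv.Perm.ofSubtype_apply_of_mem _ hx, Equiv.Perm.ofSubtype_apply_of_mem _ (hst hx), h1]
      rfl
    · rw [Equiv.Perm.ofSubtype_apply_of_not_mem _ hx]
      by_cases hxt : x ∈ t
      · rw [Equiv.Perm.ofSubtype_apply_of_mem _ hxt,
          Equiv.Perm.extendDomain_apply_not_subtype σ e (b := ⟨x, hxt⟩) hx]
      · rw [Equiv.Perm.ofSubtype_apply_of_not_mem _ hxt]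

/-- The finitary alternating group of a set. -/
noncomputable def finitaryAlternating : Subgroup (Equiv.Perm α) := ⨆ s, alternatingOn α s

variable {α}

theorem mem_finitaryAlternating {σ : Equiv.Perm α} :
    σ ∈ finitaryAlternating α ↔ ∃ s, σ ∈ alternatingOn α s :=
  Subgroup.mem_iSup_of_directed (alternatingOn_mono α).directed_le

open Classical in
theorem isSimpleGroup_alternatingOn {s : Finset α} (hs : 5 ≤ s.card) :
    IsSimpleGroup (alternatingOn α s) := by
  have : IsSimpleGroup (alternatingGroup s) := alternatingGroup.isSimpleGroup (by simpa using hs)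
  exact ((alternatingGroup s).equivMapOfInjective _
    Equiv.Perm.ofSubtype_injective).symm.isSimpleGroup

open Classical in
theorem finite_alternatingOn (s : Finset α) : Finite (alternatingOn α s) :=
  Finite.of_surjective _
    ((alternatingGroup s).equivMapOfInjective _ Equiv.Perm.ofSubtype_injective).surjective

theorem alternatingOn_le_finitaryAlternating (s : Finset α) :
    alternatingOn α s ≤ finitaryAlternating α := le_iSup (alternatingOn α) s

theorem isLocallyFGSimple_finitaryAlternating [Infinite α] :
    IsLocallyFGSimple (finitaryAlternating α) := by
  classical
  rintro ⟨g, hg⟩ ⟨k, hk⟩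
  obtain ⟨s, hs⟩ := mem_finitaryAlternating.1 hg
  obtain ⟨t, ht⟩ := mem_finitaryAlternating.1 hk
  -- Five extra points ensure that the alternating group on the union is simple.
  obtain ⟨r, hr⟩ := Infinite.exists_subset_card_eq α 5
  have hcard : 5 ≤ (r ∪ (s ∪ t)).card := hr ▸ Finset.card_le_card Finset.subset_union_left
  have := isSimpleGroup_alternatingOn hcard
  have := finite_alternatingOn (r ∪ (s ∪ t))
  let e := Subgroup.subgroupOfEquivOfLe (alternatingOn_le_finitaryAlternating (r ∪ (s ∪ t)))
  have : Finite ((alternatingOn α (r ∪ (s ∪ t))).subgroupOf (finitaryAlternating α)) :=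
    Finite.of_equiv _ e.symm.toEquiv
  refine ⟨(alternatingOn α (r ∪ (s ∪ t))).subgroupOf (finitaryAlternating α), ?_, ?_, ?_, ?_⟩
  · exact (Group.fg_iff_subgroup_fg _).1 inferInstance
  · exact e.isSimpleGroup
  · exact alternatingOn_mono α (Finset.subset_union_left.trans Finset.subset_union_right) hs
  · exact alternatingOn_mono α (Finset.subset_union_right.trans Finset.subset_union_right) ht

theorem exists_threeCycle {a b c : α} (hab : a ≠ b) (hac : a ≠ c) (hbc : b ≠ c) :
    ∃ σ ∈ finitaryAlternating α, σ a = b ∧ σ b = c := by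
  classical
  let s : Finset α := {a, b, c}
  let a' : s := ⟨a, by simp [s]⟩
  let b' : s := ⟨b, by simp [s]⟩
  let c' : s := ⟨c, by simp [s]⟩
  have hab' : a' ≠ b' := fun h => hab (congrArg Subtype.val h)
  have hbc' : b' ≠ c' := fun h => hbc (congrArg Subtype.val h)
  refine ⟨Equiv.swap a b * Equiv.swap b c, mem_finitaryAlternating.2
    ⟨s, Equiv.swap a' b' * Equiv.swap b' c', ?_, ?_⟩, ?_, ?_⟩
  · rw [SetLike.mem_coe, Equiv.Perm.mem_alternatingGroup, Equiv.Perm.sign_mul,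
      Equiv.Perm.sign_swap hab', Equiv.Perm.sign_swap hbc']
    rfl
  · rw [map_mul, Equiv.Perm.ofSubtype_swap_eq, Equiv.Perm.ofSubtype_swap_eq]
  · rw [Equiv.Perm.mul_apply, Equiv.swap_apply_of_ne_of_ne hab hac, Equiv.swap_apply_left]
  · rw [Equiv.Perm.mul_apply, Equiv.swap_apply_left,
      Equiv.swap_apply_of_ne_of_ne hac.symm hbc.symm]

/-- By simplicity the centre is trivial or everything, and two 3-cycles agreeing at one point but
not at the next do not commute. -/
theorem center_finitaryAlternating [Infinite α] :
    Subgroup.center (finitaryAlternating α) = ⊥ := by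
  refine (isLocallyFGSimple_finitaryAlternating.normal_eq _ inferInstance).resolve_right
    fun htop => ?_
  let f := Infinite.natEmbedding α
  have hne : ∀ {m n : ℕ}, m ≠ n → f m ≠ f n := fun h => f.injective.ne h
  obtain ⟨σ, hσ, hσ0, hσ1⟩ := exists_threeCycle (hne (m := 0) (n := 1) (by simp))
    (hne (m := 0) (n := 2) (by simp)) (hne (m := 1) (n := 2) (by simp))
  obtain ⟨τ, hτ, hτ0, hτ1⟩ := exists_threeCycle (hne (m := 0) (n := 1) (by simp))
    (hne (m := 0) (n := 3) (by simp)) (hne (m := 1) (n := 3) (by simp))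
  have hmem : (⟨τ, hτ⟩ : finitaryAlternating α) ∈ Subgroup.center (finitaryAlternating α) :=
    htop ▸ Subgroup.mem_top _
  have hcomm : σ * τ = τ * σ :=
    congrArg Subtype.val (Subgroup.mem_center_iff.1 hmem ⟨σ, hσ⟩)
  have := DFunLike.congr_fun hcomm (f 0)
  rw [Equiv.Perm.mul_apply, Equiv.Perm.mul_apply, hτ0, hσ0, hσ1, hτ1] at this
  exact hne (m := 2) (n := 3) (by simp) this

/-- The group is a union of finite groups indexed by the finite subsets; conversely, a fixed point
`b` can be sent to any point outside `{a, b}`. -/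
theorem mk_finitaryAlternating [Infinite α] : #(finitaryAlternating α) = #α := by
  apply le_antisymm
  · have hsurj : Function.Surjective
        fun x : Σ s : Finset α, alternatingOn α s =>
          (⟨x.2, alternatingOn_le_finitaryAlternating x.1 x.2.2⟩ : finitaryAlternating α) := by
      rintro ⟨σ, hσ⟩
      obtain ⟨s, hs⟩ := mem_finitaryAlternating.1 hσ
      exact ⟨⟨s, σ, hs⟩, rfl⟩
    refine (mk_le_of_surjective hsurj).trans ?_
    rw [mk_sigma]
    calc Cardinal.sum (fun s : Finset α => #(alternatingOn α s))
        ≤ Cardinal.sum (fun _ : Finset α => ℵ₀) := by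
          refine sum_le_sum _ _ fun s => ?_
          have := finite_alternatingOn s
          exact mk_le_aleph0
      _ = #α := by
          rw [sum_const', mk_finset_of_infinite, mul_aleph0_eq (aleph0_le_mk α)]
  · obtain ⟨a, b, hab⟩ := exists_pair_ne α
    have hfin : ({a, b} : Set α).Finite := by simp
    have hcompl : #(({a, b}ᶜ : Set α)) = #α :=
      mk_compl_of_infinite _ (hfin.lt_aleph0.trans_le (aleph0_le_mk α))
    have hex : ∀ c : ({a, b}ᶜ : Set α), ∃ σ : finitaryAlternating α,
        (σ : Equiv.Perm α) b = c := by
      rintro ⟨c, hc⟩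
      simp only [Set.mem_compl_iff, Set.mem_insert_iff, Set.mem_singleton_iff, not_or] at hc
      obtain ⟨σ, hσ, -, hσc⟩ := exists_threeCycle hab (Ne.symm hc.1) (Ne.symm hc.2)
      exact ⟨⟨σ, hσ⟩, hσc⟩
    choose f hf using hex
    rw [← hcompl]
    refine mk_le_of_injective (f := f) fun c d hcd => Subtype.ext ?_
    rw [← hf, ← hf, hcd]

end FinitaryAlternating

/-! ### Comparison of heights and bounds. -/

theorem center_prod_eq_bot {G K : Type*} [Group G] [Group K] (hG : Subgroup.center G = ⊥)
    (hK : Subgroup.center K = ⊥) : Subgroup.center (G × K) = ⊥ := by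
  rw [Subgroup.eq_bot_iff_forall]
  rintro ⟨g, k⟩ h
  rw [Subgroup.mem_center_iff] at h
  have hg : g ∈ Subgroup.center G :=
    Subgroup.mem_center_iff.2 fun x => congrArg Prod.fst (h (x, 1))
  have hk : k ∈ Subgroup.center K :=
    Subgroup.mem_center_iff.2 fun x => congrArg Prod.snd (h (1, x))
  rw [hG, Subgroup.mem_bot] at hg
  rw [hK, Subgroup.mem_bot] at hk
  rw [hg, hk]
  rfl

/-- The tower of `G`, in some realisation, has terminated at `α`. -/
def AutTowerTerminatesAt (G : Type u) [Group G] (α : Ordinal.{u}) : Prop :=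
  ∃ (T : Type u) (_ : Group T) (ι : G →* T) (H : Ordinal.{u} → Subgroup T),
    IsAutTower ι H (α + 1) ∧ H (α + 1) = H α

theorem autTowerHeight_eq_sInf (G : Type u) [Group G] :
    autTowerHeight G = sInf {α | AutTowerTerminatesAt G α} := rfl

theorem AutTowerTerminatesAt.of_mulEquiv {G K : Type u} [Group G] [Group K] (e : G ≃* K)
    {α : Ordinal.{u}} (h : AutTowerTerminatesAt K α) : AutTowerTerminatesAt G α := by
  obtain ⟨T, _, ι, H, hH, heq⟩ := h
  exact ⟨T, _, _, H, hH.comp_equiv e, heq⟩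

theorem autTowerHeight_congr {G K : Type u} [Group G] [Group K] (e : G ≃* K) :
    autTowerHeight G = autTowerHeight K := by
  rw [autTowerHeight_eq_sInf, autTowerHeight_eq_sInf]
  congr 1
  ext α
  exact ⟨.of_mulEquiv e.symm, .of_mulEquiv e⟩

theorem autTowerHeight_le_prod {G S : Type u} [Group G] [Group S] (hS : IsLocallyFGSimple S)
    (hZ : Subgroup.center S = ⊥) (hcard : Cardinal.mk G < Cardinal.mk S) :
    autTowerHeight G ≤ autTowerHeight (G × S) := by
  by_contra! hlt
  set α := autTowerHeight G with hα
  have hα0 : α ≠ 0 := (bot_le.trans_lt hlt).ne'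
  -- If no realisation terminated, the infimum would be `0`, contrary to `hα0`.
  have hne : {α | AutTowerTerminatesAt G α}.Nonempty := by
    by_contra! hempty
    rw [autTowerHeight_eq_sInf, hempty, Ordinal.sInf_empty] at hα
    exact hα0 hα
  obtain ⟨T, _, ι, H, hH, heq⟩ := csInf_mem hne
  rw [← autTowerHeight_eq_sInf, ← hα] at hH heq
  have hP := hH.prod hS hZ hcard
  -- Since `α ≠ 0`, the second factor is already `Aut S` at both `α` and `α + 1`.
  have hPα : AutTowerTerminatesAt (G × S) α := ⟨_, _, _, _, hP, by
    rw [prodTower_of_ne_zero hα0, prodTower_of_ne_zero (by simp), heq]⟩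
  obtain ⟨T', _, ι', H', hH', heq'⟩ := csInf_mem (⟨α, hPα⟩ :
    {α | AutTowerTerminatesAt (G × S) α}.Nonempty)
  rw [← autTowerHeight_eq_sInf] at hH' heq'
  set β := autTowerHeight (G × S)
  have hβα : β + 1 ≤ α + 1 := (Order.add_one_le_of_lt hlt).trans (lt_add_one α).le
  -- Termination at `β` passes to the product realisation; its first factor then stops at `β < α`,
  -- against the minimality of `α`.
  have hβ := hH'.eq_of_eq (hP.restrict hβα) (lt_add_one β) heq'
  have hGβ : AutTowerTerminatesAt G β := by
    refine ⟨T, _, ι, H, hH.restrict hβα, le_antisymm (fun x hx => ?_)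
      (hH.le_succ β ((lt_add_one β).trans_le hβα))⟩
    have hx' : (x, (1 : MulAut S)) ∈ prodTower H S (β + 1) := mem_prodTower_add_one.2 hx
    obtain ⟨A, -, -, hA⟩ := exists_prodTower_eq H S β
    rw [hβ, hA, Subgroup.mem_prod] at hx'
    exact hx'.1
  exact (csInf_le' (s := {α | AutTowerTerminatesAt G α}) hGβ).not_gt hlt

/-- Up to isomorphism only the group structures on the one type `κ.out` matter, and these form a
small family with a supremum. -/
theorem exists_autTowerHeight_lt (κ : Cardinal.{u}) : ∃ σ : Ordinal.{u}, ∀ (G : Type u) [Group G],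
    Subgroup.center G = ⊥ → Cardinal.mk G = κ → autTowerHeight G < σ := by
  refine ⟨(⨆ i : Group κ.out, @autTowerHeight κ.out i) + 1, fun G _ _ hG => ?_⟩
  obtain ⟨e⟩ : Nonempty (κ.out ≃ G) := Cardinal.eq.1 (by rw [Cardinal.mk_out, hG])
  let i : Group κ.out := e.group
  rw [Order.lt_add_one_iff, ← autTowerHeight_congr (e.mulEquiv (β := G))]
  exact Ordinal.le_iSup (fun i : Group κ.out => @autTowerHeight κ.out i) i

theorem autTowerHeight_lt_autTowerBound {κ : Cardinal.{u}} {G : Type u} [Group G]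
    (hZ : Subgroup.center G = ⊥) (hG : Cardinal.mk G = κ) :
    autTowerHeight G < autTowerBound κ :=
  csInf_mem (exists_autTowerHeight_lt κ) G hZ hG

theorem corollary4p2 (θ κ : Cardinal.{u}) (hθ : Cardinal.aleph0 ≤ θ) (hθκ : θ < κ) :
    autTowerBound θ ≤ autTowerBound κ := by
  refine csInf_le' fun G _ hZ hG => ?_
  have hκ : Cardinal.aleph0 ≤ κ := hθ.trans hθκ.le
  have : Infinite κ.out := Cardinal.infinite_iff.2 (by rwa [Cardinal.mk_out])
  have hS : Cardinal.mk (finitaryAlternating κ.out) = κ := by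
    rw [mk_finitaryAlternating, Cardinal.mk_out]
  refine (autTowerHeight_le_prod isLocallyFGSimple_finitaryAlternating center_finitaryAlternating
    (by rwa [hG, hS])).trans_lt (autTowerHeight_lt_autTowerBound
      (center_prod_eq_bot hZ center_finitaryAlternating) ?_)
  rw [← Cardinal.mul_def, hG, hS]
  exact Cardinal.mul_eq_right hκ hθκ.le (Cardinal.aleph0_pos.trans_le hθ).ne'
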